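/- Let $K$ be a field of characteristic $0$, let $R=K[x_1,\dots,x_n]$, and let $I\subseteq R$ be a homogeneous ideal. For a term order $\tau$ on $R$ with $x_1>_\tau x_2>_\tau\dots>_\tau x_n$, let $\mathrm{Gin}_\tau(I)$ be the generic initial ideal of $I$ with respect to $\tau$: the ideal which equals $\mathrm{in}_\tau(g(I))$ for all $g$ in a nonempty Zariski-open subset of $\mathrm{GL}_n(K)$, where $g=(g_{ij})$ acts on $R$ as the $K$-algebra automorphism with $g(x_i)=\sum_{j} g_{ji}x_j$, and $\mathrm{in}_\tau$ denotes the ideal generated by the leading monomials of the nonzero elements. Let $L=\bigoplus_d L_d$ be the lex-segment ideal of $I$, where $L_d$ is the $K$-span of the $\dim_K I_d$ lexicographically largest monomials of degree $d$ (lexicographic order with $x_1>\dots>x_n$). Let $J=\mathrm{Gin}_{\mathrm{lex}}(I)$. Then among all generic initial ideals of $I$, $J$ is the closest to $L$, in the sense that for every term order $\tau$ with $x_1>_\tau\dots>_\tau x_n$, the ideal $H=\mathrm{Gin}_\tau(I)$ satisfies $$\dim_K (L\cap J)_j\ \ge\ \dim_K (L\cap H)_j\qquad\text{for all } j\ge 0,$$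 where the subscript $j$ denotes the homogeneous component of degree $j$. -/

import Mathlib

open MvPolynomial

attribute [local instance] MvPolynomial.gradedAlgebra

namespace Gins

noncomputable section

/-- The `K`-algebra endomorphism of `K[x_0, …, x_{n-1}]` attached to a matrix `g`, acting by
`g(x_i) = ∑ j, g_{ji} x_j`. -/
def linSubst {K : Type*} [Field K] {n : ℕ} (g : Matrix (Fin n) (Fin n) K) :
    MvPolynomial (Fin n) K →ₐ[K] MvPolynomial (Fin n) K :=
  aeval fun i => ∑ j, C (g j i) * X j

/-- The initial ideal `in_τ(I)`: the ideal generated by the leading monomials of the nonzero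
elements of `I`. -/
def initialIdeal {K : Type*} [Field K] {n : ℕ} (τ : MonomialOrder (Fin n))
    (I : Ideal (MvPolynomial (Fin n) K)) : Ideal (MvPolynomial (Fin n) K) :=
  Ideal.span ((fun a => monomial a (1 : K)) '' (τ.degree '' {f | f ∈ I ∧ f ≠ 0}))

/-- `x_0 >_τ x_1 >_τ ⋯ >_τ x_{n-1}`. -/
def VariablesDecreasing {n : ℕ} (τ : MonomialOrder (Fin n)) : Prop :=
  ∀ i j : Fin n, i < j →
    τ.toSyn (Finsupp.single j 1) < τ.toSyn (Finsupp.single i 1)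

/-- `J` is the value of `in_τ(g(I))` for a generic `g ∈ GL_n(K)`, i.e. for all `g ∈ GL_n(K)` outside
the zero locus of some nonzero polynomial `P` in the `n²` matrix entries. -/
def IsGin {K : Type*} [Field K] {n : ℕ} (τ : MonomialOrder (Fin n))
    (I J : Ideal (MvPolynomial (Fin n) K)) : Prop :=
  ∃ P : MvPolynomial (Fin n × Fin n) K, P ≠ 0 ∧
    ∀ g : GL (Fin n) K,
      eval (fun p => (g : Matrix (Fin n) (Fin n) K) p.1 p.2) P ≠ 0 →
        initialIdeal τ (I.map (linSubst (g : Matrix (Fin n) (Fin n) K))) = J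

/-! ### Existence and uniqueness of the generic initial ideal -/

/-- Over an infinite field there is at most one generic initial ideal. -/
theorem IsGin.unique {K : Type*} [Field K] [Infinite K] {n : ℕ} {τ : MonomialOrder (Fin n)}
    {I J J' : Ideal (MvPolynomial (Fin n) K)} (h : IsGin τ I J) (h' : IsGin τ I J') : J = J' := by
  obtain ⟨P, hP, hPg⟩ := h
  obtain ⟨Q, hQ, hQg⟩ := h'
  have hdet := Matrix.det_mvPolynomialX_ne_zero (Fin n) K
  have hne : P * Q * (Matrix.mvPolynomialX (Fin n) (Fin n) K).det ≠ 0 :=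
    mul_ne_zero (mul_ne_zero hP hQ) hdet
  obtain ⟨v, hv⟩ : ∃ v : Fin n × Fin n → K,
      eval v (P * Q * (Matrix.mvPolynomialX (Fin n) (Fin n) K).det) ≠ 0 := by
    by_contra! hcon
    exact hne (MvPolynomial.funext fun v => by rw [hcon v, map_zero])
  rw [map_mul, map_mul] at hv
  have hM : (Matrix.of fun i j => v (i, j)).det ≠ 0 := by
    have := right_ne_zero_of_mul hv
    rw [RingHom.map_det] at this
    convert this using 2
    ext i j
    simp [Matrix.mvPolynomialX]
  let g : GL (Fin n) K := Matrix.GeneralLinearGroup.mkOfDetNeZero _ hM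
  have hg : (fun p : Fin n × Fin n => (g : Matrix (Fin n) (Fin n) K) p.1 p.2) = v := by
    funext p
    rfl
  rw [← hPg g (by rw [hg]; exact left_ne_zero_of_mul (left_ne_zero_of_mul hv)),
    ← hQg g (by rw [hg]; exact right_ne_zero_of_mul (left_ne_zero_of_mul hv))]

/-- The substitution `x_i ↦ ∑ j, y_{ji} x_j` with indeterminate coefficients `y_{ji}`. -/
def genSubst (K : Type*) [Field K] (n : ℕ) :
    MvPolynomial (Fin n) K →+* MvPolynomial (Fin n) (MvPolynomial (Fin n × Fin n) K) :=
  eval₂Hom (C.comp C) fun i => ∑ j, C (X (j, i)) * X j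

theorem map_eval_comp_genSubst {K : Type*} [Field K] {n : ℕ} (g : Matrix (Fin n) (Fin n) K) :
    (MvPolynomial.map (eval fun p : Fin n × Fin n => g p.1 p.2)).comp (genSubst K n) =
      (linSubst g : MvPolynomial (Fin n) K →+* MvPolynomial (Fin n) K) := by
  ext i
  · simp [genSubst, linSubst]
  · simp [genSubst, linSubst]

theorem degree_sub_lt_of_coeff_eq {A : Type*} [CommRing A] {n : ℕ} (τ : MonomialOrder (Fin n))
    {p q : MvPolynomial (Fin n) A} {a : Fin n →₀ ℕ} (hp : τ.toSyn (τ.degree p) ≤ τ.toSyn a)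
    (hq : τ.toSyn (τ.degree q) ≤ τ.toSyn a) (h : p.coeff a = q.coeff a) (hne : p - q ≠ 0) :
    τ.toSyn (τ.degree (p - q)) < τ.toSyn a := by
  refine lt_of_le_of_ne (τ.degree_sub_le.trans (sup_le hp hq)) fun heq => ?_
  have h1 : τ.degree (p - q) = a := τ.toSyn.injective heq
  apply (τ.coeff_degree_ne_zero_iff (f := p - q)).2 hne
  rw [h1, coeff_sub, h, sub_self]

/-- Specialization of an ideal over a domain: away from the zeros of one nonzero element, the
leading exponents do not change. -/
theorem exists_specialization {A K : Type*} [CommRing A] [IsDomain A] [Field K] {n : ℕ}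
    (τ : MonomialOrder (Fin n)) (I : Ideal (MvPolynomial (Fin n) A)) :
    ∃ D : A, D ≠ 0 ∧ ∀ φ : A →+* K, Function.Surjective φ → φ D ≠ 0 →
      initialIdeal τ (I.map (MvPolynomial.map φ)) =
        Ideal.span ((fun a => monomial a (1 : K)) '' (τ.degree '' {f | f ∈ I ∧ f ≠ 0})) := by
  classical
  set S : Set (Fin n →₀ ℕ) := τ.degree '' {f | f ∈ I ∧ f ≠ 0} with hS
  obtain ⟨T, hTS, hT⟩ := (Submodule.fg_span_iff_fg_span_finset_subset
    ((fun a => monomial a (1 : K)) '' S)).1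
      (IsNoetherian.noetherian (Ideal.span ((fun a => monomial a (1 : K)) '' S)))
  obtain ⟨T', hT'S, hT'⟩ : ∃ T' : Finset (Fin n →₀ ℕ), (T' : Set (Fin n →₀ ℕ)) ⊆ S ∧
      (fun a => monomial a (1 : K)) '' (T' : Set (Fin n →₀ ℕ)) = (T : Set _) := by
    obtain ⟨T', h1, h2⟩ := Finset.subset_set_image_iff.1 hTS
    exact ⟨T', h1, by rw [← h2, Finset.coe_image]⟩
  have hdick : ∀ a ∈ S, ∃ t ∈ T', t ≤ a := by
    intro a ha
    have h1 : monomial a (1 : K) ∈ Ideal.span ((fun a => monomial a (1 : K)) '' (T' : Set _)) := by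
      rw [hT']
      have : monomial a (1 : K) ∈ Ideal.span ((fun a => monomial a (1 : K)) '' S) :=
        Ideal.subset_span ⟨a, ha, rfl⟩
      have e : Ideal.span ((fun a => monomial a (1 : K)) '' S) = Ideal.span (T : Set _) := hT
      rwa [e] at this
    exact mem_ideal_span_monomial_image.1 h1 a (by simp)
  choose h hh using fun t : T' => hT'S t.2
  have hD : ∀ t, τ.leadingCoeff (h t) ≠ 0 := fun t => τ.leadingCoeff_ne_zero_iff.2 (hh t).1.2
  refine ⟨∏ t, τ.leadingCoeff (h t), Finset.prod_ne_zero_iff.2 fun t _ => hD t, ?_⟩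
  intro φ hφ hφD
  rw [map_prod] at hφD
  have hφh : ∀ t, φ (τ.leadingCoeff (h t)) ≠ 0 := fun t =>
    Finset.prod_ne_zero_iff.1 hφD t (Finset.mem_univ t)
  have hdeg : ∀ f : MvPolynomial (Fin n) A, φ (τ.leadingCoeff f) ≠ 0 →
      τ.degree (MvPolynomial.map φ f) = τ.degree f ∧ MvPolynomial.map φ f ≠ 0 := by
    intro f hf
    have hc : (MvPolynomial.map φ f).coeff (τ.degree f) ≠ 0 := by
      rw [coeff_map]; exact hf
    refine ⟨τ.toSyn.injective (le_antisymm ?_ ?_), fun h0 => hc (by rw [h0, coeff_zero])⟩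
    · exact τ.degree_le_iff.2 fun b hb => τ.le_degree (support_map_subset φ f hb)
    · exact τ.le_degree (mem_support_iff.2 hc)
  have key : ∀ s : τ.syn, ∀ p ∈ I, p ≠ 0 → τ.toSyn (τ.degree p) = s →
      MvPolynomial.map φ p ≠ 0 → τ.degree (MvPolynomial.map φ p) ∈ S := by
    intro s
    induction s using WellFoundedLT.induction with
    | ind s ih =>
      intro p hp hp0 hps hφp
      by_cases hlc : φ (τ.leadingCoeff p) = 0
      · obtain ⟨t, ht, hta⟩ := hdick (τ.degree p) ⟨p, ⟨hp, hp0⟩, rfl⟩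
        set u : T' := ⟨t, ht⟩
        have hu : τ.degree (h u) = t := (hh u).2
        set c := τ.leadingCoeff (h u) with hc
        set q := monomial (τ.degree p - t) (τ.leadingCoeff p) * h u with hq
        have hlp := τ.leadingCoeff_ne_zero_iff.2 hp0
        have hmq : MvPolynomial.map φ q = 0 := by
          rw [hq, map_mul, map_monomial, hlc, monomial_zero, zero_mul]
        have hmap : MvPolynomial.map φ (C c * p - q) = C (φ c) * MvPolynomial.map φ p := by
          rw [map_sub, hmq, sub_zero, map_mul, map_C]
        have hcφ : φ c ≠ 0 := hφh u
        have hmap0 : MvPolynomial.map φ (C c * p - q) ≠ 0 := by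
          rw [hmap]
          exact mul_ne_zero (by simpa using hcφ) hφp
        have hne : C c * p - q ≠ 0 := fun h0 => hmap0 (by rw [h0, map_zero])
        have hmem : C c * p - q ∈ I :=
          I.sub_mem (I.mul_mem_left _ hp) (I.mul_mem_left _ (hh u).1.1)
        have hdq : τ.degree q = τ.degree p := by
          rw [hq, τ.degree_mul (by simpa using hlp) (hh u).1.2, τ.degree_monomial, if_neg hlp, hu,
            tsub_add_cancel_of_le hta]
        have hdc : τ.degree (C c * p) = τ.degree p := by
          rw [τ.degree_mul (C_ne_zero.2 (hD u)) hp0, τ.degree_C, zero_add]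
        have hlt : τ.toSyn (τ.degree (C c * p - q)) < s := by
          rw [← hps]
          refine degree_sub_lt_of_coeff_eq τ (by rw [hdc]) (by rw [hdq]) ?_ hne
          rw [coeff_C_mul, hq, coeff_monomial_mul', if_pos tsub_le_self,
            tsub_tsub_cancel_of_le hta, hc, mul_comm]
          congr 1
          rw [← hu]
          rfl
        have := ih _ hlt _ hmem hne rfl hmap0
        rwa [hmap, τ.degree_mul (by simpa using hcφ) hφp, τ.degree_C, zero_add] at this
      · rw [(hdeg p hlc).1]
        exact ⟨p, ⟨hp, hp0⟩, rfl⟩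
  apply le_antisymm
  · refine Ideal.span_mono (Set.image_mono ?_)
    rintro _ ⟨f, ⟨hf, hf0⟩, rfl⟩
    obtain ⟨p, hp, rfl⟩ := (Ideal.mem_map_iff_of_surjective _
      (MvPolynomial.map_surjective φ hφ)).1 hf
    exact key _ p hp (fun h0 => hf0 (by rw [h0, map_zero])) rfl hf0
  · have : Ideal.span ((fun a => monomial a (1 : K)) '' S) =
        Ideal.span ((fun a => monomial a (1 : K)) '' (T' : Set _)) := by
      rw [hT']; exact hT
    rw [this]
    refine Ideal.span_mono (Set.image_mono ?_)
    intro t ht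
    have h1 := hdeg (h ⟨t, ht⟩) (hφh _)
    exact ⟨_, ⟨Ideal.mem_map_of_mem _ (hh ⟨t, ht⟩).1.1, h1.2⟩, by rw [h1.1]; exact (hh ⟨t, ht⟩).2⟩

/-- Every ideal has a generic initial ideal with respect to every term order. -/
theorem exists_isGin {K : Type*} [Field K] {n : ℕ} (τ : MonomialOrder (Fin n))
    (I : Ideal (MvPolynomial (Fin n) K)) : ∃ J, IsGin τ I J := by
  obtain ⟨D, hD, h⟩ := exists_specialization (K := K) τ (I.map (genSubst K n))
  refine ⟨Ideal.span ((fun a => monomial a (1 : K)) ''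
    (τ.degree '' {f | f ∈ I.map (genSubst K n) ∧ f ≠ 0})), D, hD, fun g hg => ?_⟩
  rw [← h (eval fun p => (g : Matrix (Fin n) (Fin n) K) p.1 p.2)
    (fun k => ⟨C k, by simp⟩) hg, Ideal.map_map, map_eval_comp_genSubst]
  rfl

/-! ### The generic initial ideal and the lex-segment ideal -/

/-- The generic initial ideal `Gin_τ(I)` (unique when `K` is infinite, by `IsGin.unique`). -/
def gin {K : Type*} [Field K] {n : ℕ} (τ : MonomialOrder (Fin n))
    (I : Ideal (MvPolynomial (Fin n) K)) : Ideal (MvPolynomial (Fin n) K) :=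
  (exists_isGin τ I).choose

theorem isGin_gin {K : Type*} [Field K] {n : ℕ} (τ : MonomialOrder (Fin n))
    (I : Ideal (MvPolynomial (Fin n) K)) : IsGin τ I (gin τ I) :=
  (exists_isGin τ I).choose_spec

/-- The degree `j` component `V_j = V ∩ R_j` of a graded subspace `V` of `R`. -/
def component {K : Type*} [Field K] {n : ℕ} (V : Submodule K (MvPolynomial (Fin n) K)) (j : ℕ) :
    Submodule K (MvPolynomial (Fin n) K) :=
  V ⊓ homogeneousSubmodule (Fin n) K j

/-- `Lex(V)` for a space `V` of forms of degree `d`: the span of the `dim V` lexicographically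
largest monomials of degree `d`, that is, of those monomials of degree `d` which have fewer than
`dim V` monomials of degree `d` above them. -/
def lexSpace {K : Type*} [Field K] {n : ℕ} (d : ℕ) (V : Submodule K (MvPolynomial (Fin n) K)) :
    Submodule K (MvPolynomial (Fin n) K) :=
  Submodule.span K ((fun a => monomial a (1 : K)) ''
    {a : Fin n →₀ ℕ | a.degree = d ∧
      {b : Fin n →₀ ℕ | b.degree = d ∧
        MonomialOrder.lex.toSyn a < MonomialOrder.lex.toSyn b}.ncard < Module.finrank K V})

/-- The lex-segment ideal `Lex(I) = ⨁_d Lex(I_d)`, as a graded subspace of `R`. -/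
def lexSegment {K : Type*} [Field K] {n : ℕ} (I : Ideal (MvPolynomial (Fin n) K)) :
    Submodule K (MvPolynomial (Fin n) K) :=
  ⨆ d : ℕ, lexSpace d (component (I.restrictScalars K) d)

end

end Gins

/-!
Fix `g ∈ GL_n(K)` generic for both `τ` and the lexicographic order, and let `U` be the projection of
`g(I)_j` onto the span of the monomials in the lex segment `L_j`. Projecting an element whose
`τ`-leading monomial lies in `L_j` keeps that leading monomial, so the degree `j` monomials of
`L ∩ in_τ(g(I))` are leading exponents of elements of `U`; for any term order, the number of such
exponents is `dim U` (`ncard_leadingExponents`). For the lexicographic order the converse holds as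
well: `L_j` contains every monomial of degree `j` above one of its members, so the lex-leading
monomial of a nonzero projection is already the leading monomial of the element projected. Hence
`dim (L ∩ in_τ(g(I)))_j ≤ dim U ≤ dim (L ∩ in_lex(g(I)))_j`, which is
`ncard_inter_leadingExponents_le`.
-/

open MvPolynomial

attribute [local instance] MvPolynomial.gradedAlgebra

namespace Gins

noncomputable section

variable {K : Type*} [Field K] {n : ℕ}

/-- The exponents of the leading monomials of the nonzero elements of a space of polynomials. -/
def leadingExponents (τ : MonomialOrder (Fin n)) (U : Submodule K (MvPolynomial (Fin n) K)) :
    Set (Fin n →₀ ℕ) :=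
  τ.degree '' {f | f ∈ U ∧ f ≠ 0}

/-- The projection of the polynomial ring onto the span of the monomials with exponents in `S`. -/
def monomialProj (S : Finset (Fin n →₀ ℕ)) :
    MvPolynomial (Fin n) K →ₗ[K] MvPolynomial (Fin n) K :=
  ∑ a ∈ S, (monomial a).comp (lcoeff K a)

theorem coeff_monomialProj [DecidableEq (Fin n →₀ ℕ)] (S : Finset (Fin n →₀ ℕ))
    (f : MvPolynomial (Fin n) K) (b : Fin n →₀ ℕ) :
    (monomialProj S f).coeff b = if b ∈ S then f.coeff b else 0 := by
  simp only [monomialProj, LinearMap.sum_apply, LinearMap.comp_apply, lcoeff_apply, coeff_sum,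
    coeff_monomial]
  convert Finset.sum_ite_eq' S b fun a => f.coeff a

theorem monomialProj_mem_restrictSupport (S : Finset (Fin n →₀ ℕ)) (f : MvPolynomial (Fin n) K) :
    monomialProj S f ∈ restrictSupport K (S : Set (Fin n →₀ ℕ)) := by
  classical
  rw [mem_restrictSupport_iff]
  intro b hb
  have h := mem_support_iff.1 hb
  rw [coeff_monomialProj] at h
  exact (ite_ne_right_iff.1 h).1

theorem finite_restrictSupport {S : Set (Fin n →₀ ℕ)} (hS : S.Finite) :
    Module.Finite K (restrictSupport K S) :=
  have := hS.to_subtype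
  Module.Finite.of_basis (basisRestrictSupport K S)

theorem finrank_restrictSupport (S : Set (Fin n →₀ ℕ)) :
    Module.finrank K (restrictSupport K S) = S.ncard :=
  Module.finrank_eq_nat_card_basis (basisRestrictSupport K S)

/-- Polynomials with distinct leading exponents are linearly independent. -/
theorem linearIndependent_of_injective_degree (τ : MonomialOrder (Fin n)) {ι : Type*}
    (f : ι → MvPolynomial (Fin n) K) (hf : ∀ i, f i ≠ 0)
    (hinj : Function.Injective fun i => τ.degree (f i)) : LinearIndependent K f := by
  classical
  rw [linearIndependent_iff']
  intro s c hc
  by_contra! hcon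
  obtain ⟨i, his, hi⟩ := hcon
  obtain ⟨m, hm, hmax⟩ := (s.filter fun i => c i ≠ 0).exists_max_image
    (fun i => τ.toSyn (τ.degree (f i))) ⟨i, by simp [his, hi]⟩
  rw [Finset.mem_filter] at hm
  have h := congrArg (coeff (τ.degree (f m))) hc
  rw [coeff_sum, Finset.sum_eq_single m, coeff_smul, coeff_zero, smul_eq_mul, mul_eq_zero] at h
  · exact h.elim hm.2 (τ.coeff_degree_ne_zero_iff.2 (hf m))
  · intro b hb hbm
    by_cases hcb : c b = 0
    · simp [hcb]
    · rw [coeff_smul, τ.coeff_eq_zero_of_lt, smul_zero]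
      exact lt_of_le_of_ne (hmax b (by simp [hb, hcb]))
        fun h => hbm (hinj (τ.toSyn.injective h))
  · exact fun h => absurd hm.1 h

theorem leadingExponents_subset {τ : MonomialOrder (Fin n)}
    {U : Submodule K (MvPolynomial (Fin n) K)} {S : Set (Fin n →₀ ℕ)}
    (hU : U ≤ restrictSupport K S) : leadingExponents τ U ⊆ S := by
  rintro _ ⟨f, ⟨hf, hf0⟩, rfl⟩
  exact hU hf (τ.degree_mem_support hf0)

/-- The number of leading exponents of a space of polynomials is its dimension. -/
theorem ncard_leadingExponents (τ : MonomialOrder (Fin n))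
    {U : Submodule K (MvPolynomial (Fin n) K)} {S : Set (Fin n →₀ ℕ)} (hS : S.Finite)
    (hU : U ≤ restrictSupport K S) :
    (leadingExponents τ U).ncard = Module.finrank K U := by
  classical
  have hD : (leadingExponents τ U).Finite := hS.subset (leadingExponents_subset hU)
  have := finite_restrictSupport (K := K) hS
  have : Module.Finite K U := Submodule.finiteDimensional_of_le hU
  apply le_antisymm
  · choose f hf hfd using fun a : leadingExponents τ U => a.2
    have := hD.fintype
    have hli : LinearIndependent K fun a => (⟨f a, (hf a).1⟩ : U) := by
      refine LinearIndependent.of_comp U.subtype ?_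
      refine linearIndependent_of_injective_degree τ f (fun a => (hf a).2) fun a b hab => ?_
      simp only [hfd] at hab
      exact Subtype.ext hab
    rw [Set.ncard_eq_toFinset_card', Set.toFinset_card]
    exact hli.fintype_card_le_finrank
  · -- Projecting `U` onto the span of its leading monomials is injective.
    have := finite_restrictSupport (K := K) hD
    let p : U →ₗ[K] restrictSupport K (leadingExponents τ U) :=
      ((monomialProj hD.toFinset).comp U.subtype).codRestrict _ fun u => by
        simpa using monomialProj_mem_restrictSupport hD.toFinset (u : MvPolynomial (Fin n) K)
    rw [← finrank_restrictSupport (K := K)]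
    refine LinearMap.finrank_le_finrank_of_injective (f := p) ?_
    rw [injective_iff_map_eq_zero]
    intro u hu
    by_contra hu0
    have hu0' : (u : MvPolynomial (Fin n) K) ≠ 0 := by simpa using hu0
    have h : (monomialProj hD.toFinset (u : MvPolynomial (Fin n) K)).coeff
        (τ.degree (u : MvPolynomial (Fin n) K)) = 0 := by
      rw [show monomialProj hD.toFinset (u : MvPolynomial (Fin n) K) = 0 from
        congrArg Subtype.val hu, coeff_zero]
    have hmem : τ.degree (u : MvPolynomial (Fin n) K) ∈ leadingExponents τ U :=
      ⟨u, ⟨u.2, hu0'⟩, rfl⟩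
    rw [coeff_monomialProj, if_pos (by simpa using hmem)] at h
    exact τ.coeff_degree_ne_zero_iff.2 hu0' h

/-- If `S` contains every monomial of `T` that is `σ`-above a member of `S`, then, among all term
orders, `σ` puts the most leading monomials of `W ⊆ span T` into `S`. -/
theorem ncard_inter_leadingExponents_le (σ τ : MonomialOrder (Fin n)) {S T : Set (Fin n →₀ ℕ)}
    (hS : S.Finite) {W : Submodule K (MvPolynomial (Fin n) K)} (hW : W ≤ restrictSupport K T)
    (hup : ∀ a ∈ S, ∀ b ∈ T, σ.toSyn a < σ.toSyn b → b ∈ S) :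
    (S ∩ leadingExponents τ W).ncard ≤ (S ∩ leadingExponents σ W).ncard := by
  classical
  set U := W.map (monomialProj hS.toFinset)
  have hU : U ≤ restrictSupport K S := by
    rintro _ ⟨f, -, rfl⟩
    simpa using monomialProj_mem_restrictSupport hS.toFinset f
  have h1 : S ∩ leadingExponents τ W ⊆ leadingExponents τ U := by
    rintro _ ⟨ha, f, ⟨hf, hf0⟩, rfl⟩
    have hc : (monomialProj hS.toFinset f).coeff (τ.degree f) ≠ 0 := by
      simpa [coeff_monomialProj, ha] using hf0
    refine ⟨monomialProj hS.toFinset f, ⟨⟨f, hf, rfl⟩, fun h => hc (by rw [h, coeff_zero])⟩, ?_⟩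
    refine τ.toSyn.injective (le_antisymm (τ.degree_le_iff.2 fun b hb => τ.le_degree ?_)
      (τ.le_degree (mem_support_iff.2 hc)))
    rw [mem_support_iff, coeff_monomialProj] at hb
    exact mem_support_iff.2 fun h => hb (by simp [h])
  have h2 : leadingExponents σ U ⊆ S ∩ leadingExponents σ W := by
    rintro _ ⟨_, ⟨⟨f, hf, rfl⟩, hp0⟩, rfl⟩
    have hmem := σ.degree_mem_support hp0
    have hdS : σ.degree (monomialProj hS.toFinset f) ∈ S := hU ⟨f, hf, rfl⟩ hmem
    refine ⟨hdS, f, ⟨hf, fun h => hp0 (by rw [h, map_zero])⟩, ?_⟩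
    rw [mem_support_iff, coeff_monomialProj, if_pos (by simpa using hdS)] at hmem
    refine σ.toSyn.injective (le_antisymm (σ.degree_le_iff.2 fun b hb => ?_)
      (σ.le_degree (mem_support_iff.2 hmem)))
    by_contra! hlt
    have hbS : b ∈ S := hup _ hdS b (hW hf hb) hlt
    have hb0 := σ.coeff_eq_zero_of_lt hlt
    rw [coeff_monomialProj, if_pos (by simpa using hbS)] at hb0
    exact mem_support_iff.1 hb hb0
  calc _ ≤ (leadingExponents τ U).ncard :=
        Set.ncard_le_ncard h1 (hS.subset (leadingExponents_subset hU))
    _ = (leadingExponents σ U).ncard := by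
        rw [ncard_leadingExponents τ hS hU, ncard_leadingExponents σ hS hU]
    _ ≤ _ := Set.ncard_le_ncard h2 (hS.subset Set.inter_subset_left)

/-! ### Homogeneous ideals and their initial ideals -/

theorem isHomogeneous_linSubst (g : Matrix (Fin n) (Fin n) K) {f : MvPolynomial (Fin n) K} {d : ℕ}
    (hf : f.IsHomogeneous d) : (linSubst g f).IsHomogeneous d := by
  rw [← one_mul d]
  refine hf.aeval (fun i => ∑ j, C (g j i) * X j) fun i => IsHomogeneous.sum _ _ _ fun j _ => ?_
  simpa using (isHomogeneous_C (Fin n) (g j i)).mul (isHomogeneous_X K j)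

theorem isHomogeneous_map_linSubst {I : Ideal (MvPolynomial (Fin n) K)}
    (hI : I.IsHomogeneous (homogeneousSubmodule (Fin n) K)) (g : Matrix (Fin n) (Fin n) K) :
    (I.map (linSubst g)).IsHomogeneous (homogeneousSubmodule (Fin n) K) := by
  obtain ⟨s, rfl⟩ := (Ideal.IsHomogeneous.iff_exists _ _).1 hI
  rw [Ideal.map_span]
  apply Ideal.homogeneous_span
  rintro _ ⟨_, ⟨⟨f, d, hf⟩, -, rfl⟩, rfl⟩
  exact ⟨d, isHomogeneous_linSubst g hf⟩

theorem homogeneousSubmodule_eq_restrictSupport (j : ℕ) :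
    homogeneousSubmodule (Fin n) K j = restrictSupport K {a | a.degree = j} := by
  ext f
  rw [mem_restrictSupport_iff, homogeneousSubmodule_eq_finsupp_supported]
  rfl

/-- In degree `j`, the initial ideal of a homogeneous ideal `M` is spanned by the leading monomials
of the elements of `M_j`; no compatibility of `τ` with the total degree is needed. -/
theorem mem_leadingExponents_component_iff (τ : MonomialOrder (Fin n))
    {M : Ideal (MvPolynomial (Fin n) K)}
    (hM : M.IsHomogeneous (homogeneousSubmodule (Fin n) K)) {j : ℕ} {a : Fin n →₀ ℕ}
    (ha : a.degree = j) :
    a ∈ leadingExponents τ (component (M.restrictScalars K) j) ↔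
      ∃ b ∈ τ.degree '' {f | f ∈ M ∧ f ≠ 0}, b ≤ a := by
  classical
  constructor
  · rintro ⟨f, ⟨hf, hf0⟩, rfl⟩
    exact ⟨_, ⟨f, ⟨hf.1, hf0⟩, rfl⟩, le_rfl⟩
  · rintro ⟨_, ⟨f, ⟨hf, hf0⟩, rfl⟩, hba⟩
    set q := monomial (a - τ.degree f) (1 : K) * f with hq
    have hm0 : monomial (a - τ.degree f) (1 : K) ≠ 0 := by simp
    have hq0 : q ≠ 0 := mul_ne_zero hm0 hf0
    have hqd : τ.degree q = a := by
      rw [hq, τ.degree_mul hm0 hf0, τ.degree_monomial, if_neg one_ne_zero,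
        tsub_add_cancel_of_le hba]
    have hc : (homogeneousComponent j q).coeff a ≠ 0 := by
      rw [coeff_homogeneousComponent, if_pos ha, ← hqd]
      exact τ.coeff_degree_ne_zero_iff.2 hq0
    refine ⟨homogeneousComponent j q, ⟨⟨?_, homogeneousComponent_mem j q⟩,
      fun h => hc (by rw [h, coeff_zero])⟩, ?_⟩
    · exact (mem_iff_homogeneousComponent_mem hM q).1 (M.mul_mem_left _ hf) j
    · refine τ.toSyn.injective (le_antisymm (τ.degree_le_iff.2 fun b hb => ?_)
        (τ.le_degree (mem_support_iff.2 hc)))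
      rw [mem_support_iff, coeff_homogeneousComponent] at hb
      rw [← hqd]
      exact τ.le_degree (mem_support_iff.2 fun h => hb (by simp [h]))

/-- The exponents of the monomials in the lex segment `Lex(V)` of degree `d`. -/
def lexExponents (d : ℕ) (V : Submodule K (MvPolynomial (Fin n) K)) : Set (Fin n →₀ ℕ) :=
  {a | a.degree = d ∧
    {b : Fin n →₀ ℕ | b.degree = d ∧
      MonomialOrder.lex.toSyn a < MonomialOrder.lex.toSyn b}.ncard < Module.finrank K V}

theorem finite_degree_eq (d : ℕ) : {a : Fin n →₀ ℕ | a.degree = d}.Finite :=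
  (Finsupp.finite_of_degree_le d).subset fun _ h => le_of_eq h

theorem finite_lexExponents (d : ℕ) (V : Submodule K (MvPolynomial (Fin n) K)) :
    (lexExponents d V).Finite :=
  (finite_degree_eq d).subset fun _ h => h.1

theorem mem_lexExponents_of_lt {d : ℕ} {V : Submodule K (MvPolynomial (Fin n) K)}
    {a b : Fin n →₀ ℕ} (ha : a ∈ lexExponents d V) (hb : b.degree = d)
    (hab : MonomialOrder.lex.toSyn a < MonomialOrder.lex.toSyn b) : b ∈ lexExponents d V :=
  ⟨hb, (Set.ncard_le_ncard (Set.ofPred_subset_ofPred.2 fun _ hc => ⟨hc.1, hab.trans hc.2⟩)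
    ((finite_degree_eq d).subset fun _ h => h.1)).trans_lt ha.2⟩

theorem lexSegment_eq_restrictSupport (I : Ideal (MvPolynomial (Fin n) K)) :
    lexSegment I =
      restrictSupport K (⋃ d, lexExponents d (component (I.restrictScalars K) d)) := by
  rw [restrictSupport_eq_span, Set.image_iUnion, Submodule.span_iUnion]
  rfl

theorem component_lexSegment_inf_initialIdeal (τ : MonomialOrder (Fin n))
    (I : Ideal (MvPolynomial (Fin n) K)) {M : Ideal (MvPolynomial (Fin n) K)}
    (hM : M.IsHomogeneous (homogeneousSubmodule (Fin n) K)) (j : ℕ) :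
    component (lexSegment I ⊓ (initialIdeal τ M).restrictScalars K) j =
      restrictSupport K (lexExponents j (component (I.restrictScalars K) j) ∩
        leadingExponents τ (component (M.restrictScalars K) j)) := by
  ext f
  rw [component, homogeneousSubmodule_eq_restrictSupport, lexSegment_eq_restrictSupport,
    Submodule.mem_inf, Submodule.mem_inf, Submodule.restrictScalars_mem, initialIdeal,
    mem_ideal_span_monomial_image, mem_restrictSupport_iff, mem_restrictSupport_iff,
    mem_restrictSupport_iff]
  constructor
  · rintro ⟨⟨h1, h2⟩, h3⟩ a ha
    have haj : a.degree = j := h3 ha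
    obtain ⟨d, hd⟩ := Set.mem_iUnion.1 (h1 ha)
    obtain rfl : d = j := hd.1.symm.trans haj
    exact ⟨hd, (mem_leadingExponents_component_iff τ hM haj).2 (h2 a ha)⟩
  · intro h
    exact ⟨⟨fun a ha => Set.mem_iUnion.2 ⟨j, (h ha).1⟩, fun a ha =>
      (mem_leadingExponents_component_iff τ hM (h ha).1.1).1 (h ha).2⟩, fun a ha => (h ha).1.1⟩

/-- Over an infinite field, one linear change of coordinates computes the generic initial ideals
for two term orders at once. -/
theorem exists_initialIdeal_eq_gin [Infinite K] (σ τ : MonomialOrder (Fin n))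
    (I : Ideal (MvPolynomial (Fin n) K)) :
    ∃ g : Matrix (Fin n) (Fin n) K,
      initialIdeal σ (I.map (linSubst g)) = gin σ I ∧
        initialIdeal τ (I.map (linSubst g)) = gin τ I := by
  obtain ⟨P, hP, hPg⟩ := isGin_gin σ I
  obtain ⟨Q, hQ, hQg⟩ := isGin_gin τ I
  have hne : P * Q * (Matrix.mvPolynomialX (Fin n) (Fin n) K).det ≠ 0 :=
    mul_ne_zero (mul_ne_zero hP hQ) (Matrix.det_mvPolynomialX_ne_zero (Fin n) K)
  obtain ⟨v, hv⟩ : ∃ v : Fin n × Fin n → K,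
      eval v (P * Q * (Matrix.mvPolynomialX (Fin n) (Fin n) K).det) ≠ 0 := by
    by_contra! hcon
    exact hne (MvPolynomial.funext fun v => by rw [hcon v, map_zero])
  rw [map_mul, map_mul] at hv
  have hM : (Matrix.of fun i j => v (i, j)).det ≠ 0 := by
    have := right_ne_zero_of_mul hv
    rw [RingHom.map_det] at this
    convert this using 2
    ext i j
    simp [Matrix.mvPolynomialX]
  let g : GL (Fin n) K := Matrix.GeneralLinearGroup.mkOfDetNeZero _ hM
  exact ⟨g, hPg g (left_ne_zero_of_mul (left_ne_zero_of_mul hv)),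
    hQg g (right_ne_zero_of_mul (left_ne_zero_of_mul hv))⟩

end

end Gins

theorem proposition5p2 {K : Type*} [Field K] [CharZero K] {n : ℕ}
    (I : Ideal (MvPolynomial (Fin n) K))
    (hI : I.IsHomogeneous (MvPolynomial.homogeneousSubmodule (Fin n) K))
    (τ : MonomialOrder (Fin n)) (hτ : Gins.VariablesDecreasing τ) (j : ℕ) :
    Module.finrank K
        (Gins.component (Gins.lexSegment I ⊓ (Gins.gin τ I).restrictScalars K) j) ≤
      Module.finrank K
        (Gins.component
          (Gins.lexSegment I ⊓ (Gins.gin MonomialOrder.lex I).restrictScalars K) j) := by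
  have : Infinite K := Module.Free.infinite ℚ K
  obtain ⟨g, hlex, hgτ⟩ := Gins.exists_initialIdeal_eq_gin MonomialOrder.lex τ I
  have hM := Gins.isHomogeneous_map_linSubst hI g
  rw [← hlex, ← hgτ, Gins.component_lexSegment_inf_initialIdeal τ I hM,
    Gins.component_lexSegment_inf_initialIdeal _ I hM, Gins.finrank_restrictSupport,
    Gins.finrank_restrictSupport]
  refine Gins.ncard_inter_leadingExponents_le _ τ (Gins.finite_lexExponents _ _)
    (T := {a | a.degree = j}) ?_ fun a ha b hb => Gins.mem_lexExponents_of_lt ha hb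
  rw [← Gins.homogeneousSubmodule_eq_restrictSupport]
  exact inf_le_right
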